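/- Let $\mu,\nu$ be finite positive Borel measures on $\mathbb{R}$ with $\mu(\mathbb{R})=\nu(\mathbb{R})>0$, and let $\mathrm{Marg}(\mu,\nu)$ be the set of finite positive Borel measures on $\mathbb{R}^2$ with marginals $\mu$ and $\nu$. For $\varepsilon>0$, let $\pi_\varepsilon$ denote the $\varepsilon$-cyclically invariant transport plan from $\mu$ to $\nu$, that is, the measure $\pi_\varepsilon\in\mathrm{Marg}(\mu,\nu)$ that has a measurable density $f:\mathbb{R}^2\to[0,\infty)$ with respect to $\mu\otimes\nu$ such that, for all $n\ge 1$ and all $(x_1,y_1),\dots,(x_n,y_n)\in\mathbb{R}^2$, with $y_{n+1}:=y_1$, $$\prod_{i=1}^n e^{|y_i-x_i|/\varepsilon} f(x_i,y_i)=\prod_{i=1}^n e^{|y_{i+1}-x_i|/\varepsilon} f(x_i,y_{i+1}).$$ (Background, not part of the claim: such a plan is known to exist and to be unique, and whenever $\pi\mapsto\int|y-x|\,d\pi+\varepsilon\,\mathrm{Ent}(\pi\,|\,\mu\otimes\nu)$ is not identically $+\infty$ on $\mathrm{Marg}(\mu,\nu)$, it is the unique minimizer.) Let $\pi^*$ be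 a cluster point of $(\pi_\varepsilon)_{\varepsilon>0}$ as $\varepsilon\to0^+$, for the weak topology of finite measures on $\mathbb{R}^2$ (convergence against bounded continuous functions). Then: 1. $\pi^*$ is weakly multiplicative: for all Borel sets $B_1,B_2\subset\mathbb{R}$ such that $B_1\times B_2\subset\{(x,y):x\le y\}$ or $B_1\times B_2\subset\{(x,y):x\ge y\}$, the restriction of $\pi^*$ to $B_1\times B_2$ is a product $\alpha\otimes\beta$ of two finite positive Borel measures on $\mathbb{R}$; 2. $\pi^*$ is a cyclically monotone transport plan from $\mu$ to $\nu$: $\pi^*\in\mathrm{Marg}(\mu,\nu)$ and $\pi^*$ is concentrated on a Borel set $\Gamma\subset\mathbb{R}^2$ such that $\sum_{i=1}^n|y_i-x_i|\le\sum_{i=1}^n|y_{i+1}-x_i|$ for all $n\ge1$ and all $(x_1,y_1),\dots,(x_n,y_n)\in\Gamma$, with $y_{n+1}:=y_1$. -/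

import Mathlib

open MeasureTheory Filter Set
open scoped Topology NNReal ENNReal

namespace EntropicOT

/-- The closed half-plane `{x ≤ y}`. -/
def upperHalfPlane : Set (ℝ × ℝ) := {z | z.1 ≤ z.2}

/-- The closed half-plane `{x ≥ y}`. -/
def lowerHalfPlane : Set (ℝ × ℝ) := {z | z.2 ≤ z.1}

/-- The transport plans from `μ` to `ν`: finite measures on the plane with marginals `μ` and `ν`. -/
def transportPlans (μ ν : Measure ℝ) : Set (Measure (ℝ × ℝ)) :=
  {π | IsFiniteMeasure π ∧ π.map Prod.fst = μ ∧ π.map Prod.snd = ν}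

/-- Cyclical monotonicity of a set for the cost `|y - x|`. Addition in `Fin (n + 1)` is modulo
`n + 1`, so that the last point is followed by the first one. -/
def IsCyclicallyMonotoneSet (Γ : Set (ℝ × ℝ)) : Prop :=
  ∀ (n : ℕ) (p : Fin (n + 1) → ℝ × ℝ), (∀ i, p i ∈ Γ) →
    ∑ i, |(p i).2 - (p i).1| ≤ ∑ i, |(p (i + 1)).2 - (p i).1|

/-- The cyclically monotone transport plans from `μ` to `ν`: those concentrated on a (Borel)
cyclically monotone set. -/
def cyclicallyMonotonePlans (μ ν : Measure ℝ) : Set (Measure (ℝ × ℝ)) :=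
  {π | π ∈ transportPlans μ ν ∧
    ∃ Γ : Set (ℝ × ℝ), MeasurableSet Γ ∧ IsCyclicallyMonotoneSet Γ ∧ π Γᶜ = 0}

/-- `π` is an `ε`-cyclically invariant transport plan from `μ` to `ν`: it has a finite density `f`
with respect to `μ ⊗ ν` such that products of `exp (|y - x| / ε) * f (x, y)` along finite families
of points are unchanged under cyclic shifts of the second coordinates. -/
def IsCyclicallyInvariantPlan (μ ν : Measure ℝ) (ε : ℝ) (π : Measure (ℝ × ℝ)) : Prop :=
  π ∈ transportPlans μ ν ∧
    ∃ f : ℝ × ℝ → ℝ≥0, Measurable f ∧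
      π = (μ.prod ν).withDensity (fun z => (f z : ℝ≥0∞)) ∧
      ∀ (n : ℕ) (p : Fin (n + 1) → ℝ × ℝ),
        ∏ i, Real.exp (|(p i).2 - (p i).1| / ε) * (f (p i) : ℝ) =
          ∏ i, Real.exp (|(p (i + 1)).2 - (p i).1| / ε) * (f ((p i).1, (p (i + 1)).2) : ℝ)

/-- A measure on the plane that is the product of two finite measures on the line. -/
def IsProductMeasure (π : Measure (ℝ × ℝ)) : Prop :=
  ∃ α β : Measure ℝ, IsFiniteMeasure α ∧ IsFiniteMeasure β ∧ π = α.prod β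

/-- Weak multiplicativity: the restriction to each product of two Borel sets that is contained in
one of the two closed half-planes is a product measure. -/
def IsWeaklyMultiplicative (π : Measure (ℝ × ℝ)) : Prop :=
  ∀ B₁ B₂ : Set ℝ, MeasurableSet B₁ → MeasurableSet B₂ →
    (B₁ ×ˢ B₂ ⊆ upperHalfPlane ∨ B₁ ×ˢ B₂ ⊆ lowerHalfPlane) →
      IsProductMeasure (π.restrict (B₁ ×ˢ B₂))

end EntropicOT

/-! Invariance under two-point cycles already forces the density of `π ε` to be `a x * b y * exp
(-|y - x| / ε)`. On a rectangle inside one half-plane, `|y - x|` is a function of `x` plus a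
function of `y`, so `π ε` is a product there; equivalently, it satisfies an exchange identity
between four rectangles, which survives limits (`apply_prod_mul_apply_prod`). Along a cycle, the
factors `a` and `b` cancel, and only the cost gap remains: small rectangles around points violating
cyclical monotonicity have masses whose product is exponentially small in `1 / ε`
(`prod_apply_prod_le`), so these points cannot all lie in the support of the limit. Both limits need
the masses of rectangles to converge, which fixed marginals guarantee (`tendsto_measureReal_prod`).
-/

namespace EntropicOT

/-! ### Weak limits of plans with fixed marginals -/

section Convergence

variable {μ ν : Measure ℝ} {π : Measure (ℝ × ℝ)}

lemma measure_prod_univ_of_mem_transportPlans (hπ : π ∈ transportPlans μ ν) {A : Set ℝ}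
    (hA : MeasurableSet A) : π (A ×ˢ univ) = μ A := by
  rw [← hπ.2.1, Measure.map_apply measurable_fst hA, prod_univ]

lemma measure_univ_prod_of_mem_transportPlans (hπ : π ∈ transportPlans μ ν) {B : Set ℝ}
    (hB : MeasurableSet B) : π (univ ×ˢ B) = ν B := by
  rw [← hπ.2.2, Measure.map_apply measurable_snd hB, univ_prod]

lemma measureReal_prod_add_prod_compl (hπ : π ∈ transportPlans μ ν) {A B : Set ℝ}
    (hA : MeasurableSet A) (hB : MeasurableSet B) :
    π.real (A ×ˢ B) + π.real (A ×ˢ Bᶜ) = μ.real A := by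
  have := hπ.1
  rw [← measureReal_union (Disjoint.set_prod_right disjoint_compl_right A A) (hA.prod hB.compl),
    ← prod_union, union_compl_self, measureReal_def,
    measure_prod_univ_of_mem_transportPlans hπ hA, measureReal_def]

/-- The error term involves only the marginals, so it is uniform over all plans. -/
lemma measure_prod_le_add_sdiff (hπ : π ∈ transportPlans μ ν) {A B K L : Set ℝ}
    (hA : MeasurableSet A) (hB : MeasurableSet B) (hK : MeasurableSet K) (hL : MeasurableSet L) :
    π (A ×ˢ B) ≤ π (K ×ˢ L) + (μ (A \ K) + ν (B \ L)) := by
  rw [← measure_prod_univ_of_mem_transportPlans hπ (hA.diff hK),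
    ← measure_univ_prod_of_mem_transportPlans hπ (hB.diff hL)]
  refine (measure_mono ?_).trans ((measure_union_le _ _).trans
    (add_le_add_right (measure_union_le _ _) _))
  rintro ⟨x, y⟩ ⟨hx, hy⟩
  by_cases hxK : x ∈ K <;> by_cases hyL : y ∈ L <;> simp_all

variable {ι : Type*} {l : Filter ι} {πs : ι → FiniteMeasure (ℝ × ℝ)}
  {πlim : FiniteMeasure (ℝ × ℝ)}

lemma mem_transportPlans_of_tendsto [l.NeBot]
    (hπs : ∀ᶠ i in l, (πs i : Measure (ℝ × ℝ)) ∈ transportPlans μ ν)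
    (hlim : Tendsto πs l (𝓝 πlim)) : (πlim : Measure (ℝ × ℝ)) ∈ transportPlans μ ν := by
  have key : ∀ (f : ℝ × ℝ → ℝ) (_ : Continuous f) (ρ : Measure ℝ)
      (_ : ∀ᶠ i in l, (πs i : Measure (ℝ × ℝ)).map f = ρ),
      (πlim : Measure (ℝ × ℝ)).map f = ρ := by
    intro f hf ρ hρ
    obtain ⟨i, hi⟩ := hρ.exists
    have h1 := FiniteMeasure.tendsto_map_of_tendsto_of_continuous πs πlim hlim hf
    have h2 : Tendsto (fun j => (πs j).map f) l (𝓝 ((πs i).map f)) := by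
      refine tendsto_const_nhds.congr' ?_
      filter_upwards [hρ] with j hj
      apply Subtype.ext
      rw [FiniteMeasure.val_eq_toMeasure, FiniteMeasure.val_eq_toMeasure,
        FiniteMeasure.toMeasure_map, FiniteMeasure.toMeasure_map, hi, hj]
    have h3 := congrArg (fun m : FiniteMeasure ℝ => (m : Measure ℝ)) (tendsto_nhds_unique h1 h2)
    simp only [FiniteMeasure.toMeasure_map] at h3
    rw [h3, hi]
  exact ⟨inferInstance, key _ continuous_fst μ (hπs.mono fun i hi => hi.2.1),
    key _ continuous_snd ν (hπs.mono fun i hi => hi.2.2)⟩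

/-- For plans with fixed marginals, the upper semicontinuity of weak limits on closed sets extends
to products of arbitrary Borel sets. -/
lemma eventually_measure_prod_lt [IsFiniteMeasure μ] [IsFiniteMeasure ν]
    (hπs : ∀ᶠ i in l, (πs i : Measure (ℝ × ℝ)) ∈ transportPlans μ ν)
    (hlim : Tendsto πs l (𝓝 πlim)) {A B : Set ℝ} (hA : MeasurableSet A) (hB : MeasurableSet B)
    {c : ℝ≥0∞} (hc : (πlim : Measure (ℝ × ℝ)) (A ×ˢ B) < c) :
    ∀ᶠ i in l, (πs i : Measure (ℝ × ℝ)) (A ×ˢ B) < c := by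
  obtain ⟨d, hd, hdc⟩ := exists_between hc
  have hδ : c - d ≠ 0 := (tsub_pos_of_lt hdc).ne'
  have hδ2 : (c - d) / 2 ≠ 0 := (ENNReal.half_pos hδ).ne'
  obtain ⟨K, hKA, hK, hAK⟩ := hA.exists_isClosed_sdiff_lt (measure_ne_top μ A) hδ2
  obtain ⟨L, hLB, hL, hBL⟩ := hB.exists_isClosed_sdiff_lt (measure_ne_top ν B) hδ2
  have hsup : l.limsup (fun i => (πs i : Measure (ℝ × ℝ)) (K ×ˢ L)) < d :=
    ((FiniteMeasure.limsup_measure_closed_le_of_tendsto hlim (hK.prod hL)).trans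
      (measure_mono (prod_mono hKA hLB))).trans_lt hd
  filter_upwards [eventually_lt_of_limsup_lt hsup, hπs] with i hi hi'
  calc (πs i : Measure (ℝ × ℝ)) (A ×ˢ B)
      ≤ (πs i : Measure (ℝ × ℝ)) (K ×ˢ L) + (μ (A \ K) + ν (B \ L)) :=
        measure_prod_le_add_sdiff hi' hA hB hK.measurableSet hL.measurableSet
    _ < d + ((c - d) / 2 + (c - d) / 2) := ENNReal.add_lt_add hi (ENNReal.add_lt_add hAK hBL)
    _ = c := by rw [ENNReal.add_halves, add_tsub_cancel_of_le hdc.le]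

/-- For plans with fixed marginals, weak convergence implies convergence on all products of Borel
sets. -/
lemma tendsto_measureReal_prod [IsFiniteMeasure μ] [IsFiniteMeasure ν] [l.NeBot]
    (hπs : ∀ᶠ i in l, (πs i : Measure (ℝ × ℝ)) ∈ transportPlans μ ν)
    (hlim : Tendsto πs l (𝓝 πlim)) {A B : Set ℝ} (hA : MeasurableSet A) (hB : MeasurableSet B) :
    Tendsto (fun i => (πs i : Measure (ℝ × ℝ)).real (A ×ˢ B)) l
      (𝓝 ((πlim : Measure (ℝ × ℝ)).real (A ×ˢ B))) := by
  have key : ∀ (B : Set ℝ) (_ : MeasurableSet B) (c : ℝ),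
      (πlim : Measure (ℝ × ℝ)).real (A ×ˢ B) < c →
        ∀ᶠ i in l, (πs i : Measure (ℝ × ℝ)).real (A ×ˢ B) < c := by
    intro B hB c hc
    have hc0 : 0 < c := measureReal_nonneg.trans_lt hc
    have := eventually_measure_prod_lt hπs hlim hA hB (c := ENNReal.ofReal c)
      ((ENNReal.lt_ofReal_iff_toReal_lt (measure_ne_top _ _)).2 hc)
    filter_upwards [this] with i hi
    exact (ENNReal.lt_ofReal_iff_toReal_lt (measure_ne_top _ _)).1 hi
  refine tendsto_order.2 ⟨fun c hc => ?_, key B hB⟩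
  -- Since the two masses add up to `μ.real A`, an upper bound on `A ×ˢ Bᶜ` is a lower bound on `A
  -- ×ˢ B`.
  have hl := measureReal_prod_add_prod_compl (mem_transportPlans_of_tendsto hπs hlim) hA hB
  filter_upwards [key Bᶜ hB.compl (μ.real A - c) (by linarith), hπs] with i hi hi'
  have := measureReal_prod_add_prod_compl hi' hA hB
  linarith

end Convergence

/-! ### Factorized densities and their rectangle estimates -/

section Density

variable {μ ν : Measure ℝ} {ε : ℝ} {π : Measure (ℝ × ℝ)}

/-- The density of a plan in terms of two potentials, written multiplicatively. -/
def HasGibbsDensity (μ ν : Measure ℝ) (ε : ℝ) (a b : ℝ → ℝ≥0∞) (π : Measure (ℝ × ℝ)) : Prop :=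
  Measurable a ∧ Measurable b ∧ π = (μ.prod ν).withDensity
    (fun z => a z.1 * b z.2 * ENNReal.ofReal (Real.exp (-(|z.2 - z.1| / ε))))

lemma IsCyclicallyInvariantPlan.exists_hasGibbsDensity (h : IsCyclicallyInvariantPlan μ ν ε π) :
    ∃ a b : ℝ → ℝ≥0∞, HasGibbsDensity μ ν ε a b π := by
  obtain ⟨-, f, hf, rfl, hcyc⟩ := h
  by_cases h0 : ∃ z, f z ≠ 0
  · obtain ⟨⟨x₀, y₀⟩, hz⟩ := h0
    set g : ℝ → ℝ → ℝ := fun x y => Real.exp (|y - x| / ε) * f (x, y) with hg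
    have hg0 : g x₀ y₀ ≠ 0 :=
      mul_ne_zero (Real.exp_pos _).ne' (by simpa using hz)
    have hgn : ∀ x y, 0 ≤ g x y := fun x y => by positivity
    -- The two-point cycle with a base point where `g` is nonzero makes `g` a matrix of rank one.
    have hswap : ∀ x y, g x y * g x₀ y₀ = g x y₀ * g x₀ y := by
      intro x y
      have := hcyc 1 ![(x, y), (x₀, y₀)]
      simpa [Fin.prod_univ_two, hg] using this
    refine ⟨fun x => ENNReal.ofReal (g x y₀ / g x₀ y₀), fun y => ENNReal.ofReal (g x₀ y), ?_, ?_, ?_⟩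
    · simp only [hg]; fun_prop
    · simp only [hg]; fun_prop
    · congr 1
      funext ⟨x, y⟩
      dsimp only
      rw [← ENNReal.ofReal_mul (div_nonneg (hgn _ _) (hgn _ _)),
        ← ENNReal.ofReal_mul (mul_nonneg (div_nonneg (hgn _ _) (hgn _ _)) (hgn _ _)),
        ← ENNReal.ofReal_coe_nnreal]
      congr 1
      rw [div_mul_eq_mul_div, ← hswap, mul_div_cancel_right₀ _ hg0, mul_right_comm,
        ← Real.exp_add, add_neg_cancel, Real.exp_zero, one_mul]
  · push Not at h0
    exact ⟨0, 0, measurable_zero, measurable_zero, by simp [h0]⟩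

variable {a b : ℝ → ℝ≥0∞}

lemma HasGibbsDensity.apply_prod [SFinite μ] [SFinite ν] (h : HasGibbsDensity μ ν ε a b π)
    {A B : Set ℝ} (hA : MeasurableSet A) (hB : MeasurableSet B) :
    π (A ×ˢ B) = ∫⁻ z in A ×ˢ B,
      a z.1 * b z.2 * ENNReal.ofReal (Real.exp (-(|z.2 - z.1| / ε))) ∂(μ.prod ν) := by
  rw [h.2.2, withDensity_apply _ (hA.prod hB)]

lemma setLIntegral_prod_mul [SFinite μ] [SFinite ν] (ha : Measurable a) (hb : Measurable b)
    (A B : Set ℝ) : ∫⁻ z in A ×ˢ B, a z.1 * b z.2 ∂(μ.prod ν) =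
      (∫⁻ x in A, a x ∂μ) * ∫⁻ y in B, b y ∂ν := by
  rw [← Measure.prod_restrict, lintegral_prod_mul ha.aemeasurable hb.aemeasurable]

lemma HasGibbsDensity.apply_prod_le [SFinite μ] [SFinite ν] (h : HasGibbsDensity μ ν ε a b π)
    (hε : 0 < ε) {A B : Set ℝ} (hA : MeasurableSet A) (hB : MeasurableSet B) {m : ℝ}
    (hm : ∀ x ∈ A, ∀ y ∈ B, m ≤ |y - x|) :
    π (A ×ˢ B) ≤ ENNReal.ofReal (Real.exp (-(m / ε))) *
      ((∫⁻ x in A, a x ∂μ) * ∫⁻ y in B, b y ∂ν) := by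
  have h1 := h.1
  have h2 := h.2.1
  rw [h.apply_prod hA hB, ← setLIntegral_prod_mul h1 h2, ← lintegral_const_mul _ (by fun_prop)]
  refine setLIntegral_mono' (hA.prod hB) fun z hz => ?_
  rw [mul_comm]
  gcongr
  exact hm _ hz.1 _ hz.2

lemma HasGibbsDensity.le_apply_prod [SFinite μ] [SFinite ν] (h : HasGibbsDensity μ ν ε a b π)
    (hε : 0 < ε) {A B : Set ℝ} (hA : MeasurableSet A) (hB : MeasurableSet B) {M : ℝ}
    (hM : ∀ x ∈ A, ∀ y ∈ B, |y - x| ≤ M) :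
    (∫⁻ x in A, a x ∂μ) * ∫⁻ y in B, b y ∂ν ≤
      ENNReal.ofReal (Real.exp (M / ε)) * π (A ×ˢ B) := by
  have h1 := h.1
  have h2 := h.2.1
  rw [h.apply_prod hA hB, ← setLIntegral_prod_mul h1 h2, ← lintegral_const_mul _ (by fun_prop)]
  refine setLIntegral_mono' (hA.prod hB) fun z hz => ?_
  have : (1 : ℝ≥0∞) ≤ ENNReal.ofReal (Real.exp (M / ε)) *
      ENNReal.ofReal (Real.exp (-(|z.2 - z.1| / ε))) := by
    rw [← ENNReal.ofReal_mul (Real.exp_pos _).le, ← Real.exp_add, ENNReal.one_le_ofReal,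
      Real.one_le_exp_iff, ← sub_eq_add_neg, sub_nonneg]
    gcongr
    exact hM _ hz.1 _ hz.2
  calc a z.1 * b z.2 = a z.1 * b z.2 * 1 := (mul_one _).symm
    _ ≤ a z.1 * b z.2 * (ENNReal.ofReal (Real.exp (M / ε)) *
      ENNReal.ofReal (Real.exp (-(|z.2 - z.1| / ε)))) := by gcongr
    _ = _ := by ring

/-- Where the cost is additively separated, the plan satisfies the exchange relation that
characterizes product measures. -/
lemma HasGibbsDensity.apply_prod_mul_apply_prod [SFinite μ] [SFinite ν]
    (h : HasGibbsDensity μ ν ε a b π) {B₁ B₂ : Set ℝ} (hB₁ : MeasurableSet B₁)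
    (hB₂ : MeasurableSet B₂) {s : ℝ} (hs : ∀ x ∈ B₁, ∀ y ∈ B₂, |y - x| = s * (y - x))
    {A₁ A₂ : Set ℝ} (hA₁ : MeasurableSet A₁) (hA₂ : MeasurableSet A₂) (h₁ : A₁ ⊆ B₁)
    (h₂ : A₂ ⊆ B₂) :
    π (A₁ ×ˢ A₂) * π (B₁ ×ˢ B₂) = π (A₁ ×ˢ B₂) * π (B₁ ×ˢ A₂) := by
  have h1 := h.1
  have h2 := h.2.1
  have key : ∀ C₁ C₂ : Set ℝ, MeasurableSet C₁ → MeasurableSet C₂ → C₁ ⊆ B₁ → C₂ ⊆ B₂ →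
      π (C₁ ×ˢ C₂) = (∫⁻ x in C₁, a x * ENNReal.ofReal (Real.exp (s * x / ε)) ∂μ) *
        ∫⁻ y in C₂, b y * ENNReal.ofReal (Real.exp (-(s * y / ε))) ∂ν := by
    intro C₁ C₂ hC₁ hC₂ hs₁ hs₂
    rw [h.apply_prod hC₁ hC₂, ← setLIntegral_prod_mul (by fun_prop) (by fun_prop)]
    refine setLIntegral_congr_fun (hC₁.prod hC₂) fun z hz => ?_
    have : Real.exp (-(|z.2 - z.1| / ε)) =
        Real.exp (s * z.1 / ε) * Real.exp (-(s * z.2 / ε)) := by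
      rw [hs _ (hs₁ hz.1) _ (hs₂ hz.2), ← Real.exp_add]
      congr 1
      ring
    simp only [this, ENNReal.ofReal_mul (Real.exp_pos _).le]
    ring
  rw [key _ _ hA₁ hA₂ h₁ h₂, key _ _ hB₁ hB₂ subset_rfl subset_rfl,
    key _ _ hA₁ hB₂ h₁ subset_rfl, key _ _ hB₁ hA₂ subset_rfl h₂]
  ring

/-- If the total cost of a family of rectangles exceeds, uniformly, that of the shifted family,
then the plan gives exponentially small mass to the former. -/
lemma HasGibbsDensity.prod_apply_prod_le [SFinite μ] [SFinite ν]
    (h : HasGibbsDensity μ ν ε a b π) (hε : 0 < ε) {n : ℕ} {A B : Fin (n + 1) → Set ℝ}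
    (hA : ∀ i, MeasurableSet (A i)) (hB : ∀ i, MeasurableSet (B i)) {m M : Fin (n + 1) → ℝ}
    (hm : ∀ i, ∀ x ∈ A i, ∀ y ∈ B i, m i ≤ |y - x|)
    (hM : ∀ i, ∀ x ∈ A i, ∀ y ∈ B (i + 1), |y - x| ≤ M i) :
    ∏ i, π (A i ×ˢ B i) ≤ ENNReal.ofReal (Real.exp (-((∑ i, m i - ∑ i, M i) / ε))) *
      ∏ i, π (A i ×ˢ B (i + 1)) := by
  have hexp : ∀ c : Fin (n + 1) → ℝ, ∏ i, ENNReal.ofReal (Real.exp (c i)) =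
      ENNReal.ofReal (Real.exp (∑ i, c i)) := fun c => by
    rw [Real.exp_sum, ENNReal.ofReal_prod_of_nonneg fun i _ => (Real.exp_pos _).le]
  calc ∏ i, π (A i ×ˢ B i)
      ≤ ∏ i, ENNReal.ofReal (Real.exp (-(m i / ε))) *
        ((∫⁻ x in A i, a x ∂μ) * ∫⁻ y in B i, b y ∂ν) :=
        Finset.prod_le_prod' fun i _ => h.apply_prod_le hε (hA i) (hB i) (hm i)
    _ = (∏ i, ENNReal.ofReal (Real.exp (-(m i / ε)))) *
        ∏ i, ((∫⁻ x in A i, a x ∂μ) * ∫⁻ y in B (i + 1), b y ∂ν) := by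
        -- The cyclic shift merely permutes the integrals of `b`. Working in `ℝ≥0∞` avoids any
        -- integrability of `a` and `b`.
        simp only [Finset.prod_mul_distrib]
        rw [← Equiv.prod_comp (Equiv.addRight (1 : Fin (n + 1)))
          (fun i => ∫⁻ y in B i, b y ∂ν)]
        rfl
    _ ≤ (∏ i, ENNReal.ofReal (Real.exp (-(m i / ε)))) *
        ∏ i, ENNReal.ofReal (Real.exp (M i / ε)) * π (A i ×ˢ B (i + 1)) := by
        exact mul_le_mul_right (Finset.prod_le_prod' fun i _ =>
          h.le_apply_prod hε (hA i) (hB (i + 1)) (hM i)) _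
    _ = _ := by
        rw [Finset.prod_mul_distrib, ← mul_assoc, hexp, hexp,
          ← ENNReal.ofReal_mul (Real.exp_pos _).le, ← Real.exp_add]
        congr 4
        rw [Finset.sum_neg_distrib, ← Finset.sum_div, ← Finset.sum_div]
        ring

end Density

/-- A finite measure on the plane satisfying the exchange relation on the measurable rectangles in
`B₁ ×ˢ B₂` is a product measure there. -/
lemma isProductMeasure_restrict_prod {π : Measure (ℝ × ℝ)} [IsFiniteMeasure π] {B₁ B₂ : Set ℝ}
    (hB₁ : MeasurableSet B₁) (hB₂ : MeasurableSet B₂)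
    (h : ∀ A₁ A₂ : Set ℝ, MeasurableSet A₁ → MeasurableSet A₂ → A₁ ⊆ B₁ → A₂ ⊆ B₂ →
      π (A₁ ×ˢ A₂) * π (B₁ ×ˢ B₂) = π (A₁ ×ˢ B₂) * π (B₁ ×ˢ A₂)) :
    IsProductMeasure (π.restrict (B₁ ×ˢ B₂)) := by
  by_cases h0 : π (B₁ ×ˢ B₂) = 0
  · exact ⟨0, 0, inferInstance, inferInstance, by simp [Measure.restrict_eq_zero.2 h0]⟩
  have htop : π (B₁ ×ˢ B₂) ≠ ⊤ := measure_ne_top _ _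
  set ρ := π.restrict (B₁ ×ˢ B₂) with hρ
  -- The factors are the marginals of `ρ`, one of them divided by the total mass that the exchange
  -- relation leaves over.
  have hfin : IsFiniteMeasure ((π (B₁ ×ˢ B₂))⁻¹ • ρ.map Prod.fst) :=
    Measure.smul_finite _ (ENNReal.inv_ne_top.2 h0)
  refine ⟨(π (B₁ ×ˢ B₂))⁻¹ • ρ.map Prod.fst, ρ.map Prod.snd, hfin, inferInstance, ?_⟩
  refine (Measure.prod_eq fun s t hs ht => ?_).symm
  rw [Measure.smul_apply, smul_eq_mul, Measure.map_apply measurable_fst hs,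
    Measure.map_apply measurable_snd ht, hρ, Measure.restrict_apply (hs.prod ht),
    Measure.restrict_apply (measurable_fst hs), Measure.restrict_apply (measurable_snd ht),
    ← prod_univ, ← univ_prod, prod_inter_prod, prod_inter_prod, prod_inter_prod, univ_inter,
    univ_inter, mul_assoc, ← h _ _ (hs.inter hB₁) (ht.inter hB₂) inter_subset_right
      inter_subset_right, mul_comm, mul_assoc, ENNReal.mul_inv_cancel h0 htop, mul_one]

/-! ### Passage to the limit -/

section Limit

variable {μ ν : Measure ℝ} [IsFiniteMeasure μ] [IsFiniteMeasure ν] {l : Filter ℝ} [l.NeBot]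
  {π : ℝ → FiniteMeasure (ℝ × ℝ)} {πlim : FiniteMeasure (ℝ × ℝ)}

lemma isWeaklyMultiplicative_of_tendsto
    (hπ : ∀ᶠ ε in l, IsCyclicallyInvariantPlan μ ν ε (π ε : Measure (ℝ × ℝ)))
    (hlim : Tendsto π l (𝓝 πlim)) : IsWeaklyMultiplicative (πlim : Measure (ℝ × ℝ)) := by
  intro B₁ B₂ hB₁ hB₂ hB
  obtain ⟨s, hs⟩ : ∃ s : ℝ, ∀ x ∈ B₁, ∀ y ∈ B₂, |y - x| = s * (y - x) := by
    rcases hB with hB | hB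
    · refine ⟨1, fun x hx y hy => ?_⟩
      have : x ≤ y := hB (mk_mem_prod hx hy)
      rw [abs_of_nonneg (sub_nonneg.2 this), one_mul]
    · refine ⟨-1, fun x hx y hy => ?_⟩
      have : y ≤ x := hB (mk_mem_prod hx hy)
      rw [abs_of_nonpos (sub_nonpos.2 this), neg_one_mul]
  refine isProductMeasure_restrict_prod hB₁ hB₂ fun A₁ A₂ hA₁ hA₂ h₁ h₂ => ?_
  have hplan := hπ.mono fun ε hε => hε.1
  have ht := fun {A B : Set ℝ} (hA : MeasurableSet A) (hB : MeasurableSet B) =>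
    tendsto_measureReal_prod hplan hlim hA hB
  have heq := tendsto_nhds_unique (((ht hA₁ hA₂).mul (ht hB₁ hB₂)).congr' (by
    filter_upwards [hπ] with ε hε
    obtain ⟨a, b, hab⟩ := hε.exists_hasGibbsDensity
    simp only [measureReal_def, ← ENNReal.toReal_mul]
    rw [hab.apply_prod_mul_apply_prod hB₁ hB₂ hs hA₁ hA₂ h₁ h₂]))
    (((ht hA₁ hB₂).mul (ht hB₁ hA₂)).congr fun ε => by
      simp only [measureReal_def, ← ENNReal.toReal_mul])
  simp only [measureReal_def, ← ENNReal.toReal_mul] at heq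
  exact (ENNReal.toReal_eq_toReal_iff' (ENNReal.mul_ne_top (measure_ne_top _ _)
    (measure_ne_top _ _)) (ENNReal.mul_ne_top (measure_ne_top _ _) (measure_ne_top _ _))).1 heq

lemma isCyclicallyMonotoneSet_support_of_tendsto (hl : l ≤ 𝓝[>] 0)
    (hπ : ∀ᶠ ε in l, IsCyclicallyInvariantPlan μ ν ε (π ε : Measure (ℝ × ℝ)))
    (hlim : Tendsto π l (𝓝 πlim)) :
    IsCyclicallyMonotoneSet (πlim : Measure (ℝ × ℝ)).support := by
  intro n p hp
  by_contra! hlt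
  set δ := ∑ i, |(p i).2 - (p i).1| - ∑ i, |(p (i + 1)).2 - (p i).1| with hδ
  have hδ0 : 0 < δ := sub_pos.2 hlt
  -- Each of the `2 * (n + 1)` distances varies by at most `2 * r`, so half of the gap `δ` survives
  -- on the balls.
  set r : ℝ := δ / (8 * (n + 1)) with hr
  have hr0 : 0 < r := by positivity
  set A : Fin (n + 1) → Set ℝ := fun i => Metric.ball (p i).1 r
  set B : Fin (n + 1) → Set ℝ := fun i => Metric.ball (p i).2 r
  have hA : ∀ i, MeasurableSet (A i) := fun i => measurableSet_ball
  have hB : ∀ i, MeasurableSet (B i) := fun i => measurableSet_ball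
  have hclose : ∀ i j, ∀ x ∈ A i, ∀ y ∈ B j,
      |(|y - x| - |(p j).2 - (p i).1|)| ≤ 2 * r := by
    intro i j x hx y hy
    simp only [A, B, Metric.mem_ball, Real.dist_eq] at hx hy
    calc |(|y - x| - |(p j).2 - (p i).1|)| ≤ |(y - x) - ((p j).2 - (p i).1)| :=
          abs_abs_sub_abs_le _ _
      _ = |(y - (p j).2) - (x - (p i).1)| := by congr 1; ring
      _ ≤ |y - (p j).2| + |x - (p i).1| := abs_sub _ _
      _ ≤ 2 * r := by linarith
  have hplan := hπ.mono fun ε hε => hε.1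
  have hbound : ∀ᶠ ε in l, ∏ i, (π ε : Measure (ℝ × ℝ)).real (A i ×ˢ B i) ≤
      Real.exp (-(δ / 2 / ε)) * μ.real univ ^ (n + 1) := by
    filter_upwards [hπ, hl self_mem_nhdsWithin] with ε hε hε0
    obtain ⟨a, b, hab⟩ := hε.exists_hasGibbsDensity
    have h1 := hab.prod_apply_prod_le hε0 hA hB
      (m := fun i => |(p i).2 - (p i).1| - 2 * r)
      (M := fun i => |(p (i + 1)).2 - (p i).1| + 2 * r)
      (fun i x hx y hy => by linarith [(abs_le.1 (hclose i i x hx y hy)).1])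
      (fun i x hx y hy => by linarith [(abs_le.1 (hclose i (i + 1) x hx y hy)).2])
    have h2 : ∑ i, (|(p i).2 - (p i).1| - 2 * r) -
        ∑ i, (|(p (i + 1)).2 - (p i).1| + 2 * r) = δ / 2 := by
      rw [Finset.sum_sub_distrib, Finset.sum_add_distrib]
      simp only [Finset.sum_const, Finset.card_univ, Fintype.card_fin, nsmul_eq_mul]
      have : ((n + 1 : ℕ) : ℝ) * (2 * r) = δ / 4 := by
        rw [hr]
        push_cast
        field_simp
        ring
      rw [this]
      linarith
    rw [h2] at h1
    have h3 := ENNReal.toReal_mono (ENNReal.mul_ne_top ENNReal.ofReal_ne_top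
      (ENNReal.prod_ne_top fun i _ => measure_ne_top _ _)) h1
    rw [ENNReal.toReal_mul, ENNReal.toReal_prod, ENNReal.toReal_prod,
      ENNReal.toReal_ofReal (Real.exp_pos _).le] at h3
    refine h3.trans ?_
    gcongr
    calc _ ≤ ∏ _i : Fin (n + 1), μ.real univ := by
          refine Finset.prod_le_prod (fun i _ => ENNReal.toReal_nonneg) fun i _ => ?_
          have := measure_prod_univ_of_mem_transportPlans hε.1 MeasurableSet.univ
          rw [measureReal_def, ← this]
          exact ENNReal.toReal_mono (measure_ne_top _ _)
            (measure_mono (prod_mono (subset_univ _) (subset_univ _)))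
      _ = μ.real univ ^ (n + 1) := by simp
  have hzero : Tendsto (fun ε : ℝ => Real.exp (-(δ / 2 / ε)) * μ.real univ ^ (n + 1)) l (𝓝 0) := by
    have : Tendsto (fun ε : ℝ => δ / 2 / ε) l atTop := by
      simp only [div_eq_mul_inv (δ / 2)]
      exact (tendsto_inv_nhdsGT_zero.const_mul_atTop (half_pos hδ0)).mono_left hl
    simpa using (Real.tendsto_exp_neg_atTop_nhds_zero.comp this).mul_const (μ.real univ ^ (n + 1))
  have hle := le_of_tendsto_of_tendsto (tendsto_finsetProd Finset.univ fun i _ =>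
    tendsto_measureReal_prod hplan hlim (hA i) (hB i)) hzero hbound
  -- Neighbourhoods of support points have positive mass, so the limiting product cannot vanish.
  refine hle.not_gt (Finset.prod_pos fun i _ => ?_)
  refine ENNReal.toReal_pos (Measure.mem_support_iff_forall (p i) |>.1 (hp i) _ ?_).ne'
    (measure_ne_top _ _)
  exact prod_mem_nhds (Metric.ball_mem_nhds _ hr0) (Metric.ball_mem_nhds _ hr0)

end Limit

end EntropicOT

theorem mainTheorem2 (μ ν : Measure ℝ) [IsFiniteMeasure μ] [IsFiniteMeasure ν]
    (hmass : μ univ = ν univ) (hpos : 0 < μ univ)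
    (π : ℝ → FiniteMeasure (ℝ × ℝ))
    (hπ : ∀ ε : ℝ, 0 < ε →
      EntropicOT.IsCyclicallyInvariantPlan μ ν ε (π ε : Measure (ℝ × ℝ)))
    (πstar : FiniteMeasure (ℝ × ℝ))
    (hcluster : MapClusterPt πstar (𝓝[>] (0 : ℝ)) π) :
    EntropicOT.IsWeaklyMultiplicative (πstar : Measure (ℝ × ℝ)) ∧
      (πstar : Measure (ℝ × ℝ)) ∈ EntropicOT.cyclicallyMonotonePlans μ ν := by
  -- An ultrafilter turns the cluster point into a true limit, with no extraction of a subsequence.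
  obtain ⟨U, hU, hlim⟩ := mapClusterPt_iff_ultrafilter.1 hcluster
  have hinv : ∀ᶠ ε in (U : Filter ℝ),
      EntropicOT.IsCyclicallyInvariantPlan μ ν ε (π ε : Measure (ℝ × ℝ)) :=
    hU (Filter.mem_of_superset self_mem_nhdsWithin hπ)
  exact ⟨EntropicOT.isWeaklyMultiplicative_of_tendsto hinv hlim,
    EntropicOT.mem_transportPlans_of_tendsto (hinv.mono fun ε hε => hε.1) hlim,
    (πstar : Measure (ℝ × ℝ)).support, Measure.isClosed_support.measurableSet,
    EntropicOT.isCyclicallyMonotoneSet_support_of_tendsto hU hinv hlim,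
    Measure.measure_compl_support⟩
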